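/- Let $n\ge 0$, let $\mathcal H=(\mathbb C^2)^{\otimes n}$ have computational basis $|x\rangle$, $x\in\{0,1\}^n$, and let $b_1,\dots,b_n$ be the fermionic annihilation operators in this (occupation number) basis: $b_j|x\rangle=(-1)^{x_1+\dots+x_{j-1}}|x\text{ with }x_j\text{ replaced by }0\rangle$ if $x_j=1$, and $b_j|x\rangle=0$ if $x_j=0$. Let $\gamma_{2j-1}=b_j+b_j^\dagger$ and $\gamma_{2j}=-i(b_j-b_j^\dagger)$ be the $2n$ Majorana operators, and for $S=\{l_1<\dots<l_m\}\subseteq\{1,\dots,2n\}$ let $\gamma_S=\gamma_{l_1}\cdots\gamma_{l_m}$, with $\gamma_\emptyset=\mathbb I$. For an operator $O\neq 0$ write $|O\rangle\rangle=O/\sqrt{\operatorname{tr}(OO^\dagger)}$ and let $\langle\langle O|$ be the functional $A\mapsto\operatorname{tr}(O^\dagger A)/\sqrt{\operatorname{tr}(OO^\dagger)}$; write $|x\rangle\rangle$ for the case $O=|x\rangle\langle x|$, and $|\mathbf 0\rangle\rangle$ for $x=(0,\dots,0)$. Let $\mathcal P_{m}=\sum_{|S|=m}|\gamma_S\rangle\rangle\langle\langle\gamma_S|$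 and $\mathcal X=\sum_{x\in\{0,1\}^n}|x\rangle\rangle\langle\langle x|$. For $Q\in\mathrm{Orth}(2n)$ let $U_Q$ be the matchgate (fermionic Gaussian unitary) with $U_Q^\dagger\gamma_uU_Q=\sum_{v}Q_{uv}\gamma_v$ for all $u$, which exists and is unique up to a global phase. Put $\mathcal U_Q(A)=U_QAU_Q^\dagger$ and $\mathcal U_Q^\dagger(A)=U_Q^\dagger AU_Q$. Let $\mu$ be the normalised Haar measure on $\mathrm{Orth}(2n)$. Let $\Lambda$ be a completely positive trace-preserving linear map on the operators on $\mathcal H$ (the noise), and let $$\widetilde{\mathcal M}=\int \mathcal U_Q^\dagger\,\mathcal X\,\Lambda\,\mathcal U_Q\,d\mu(Q)$$ be the noisy fermionic shadow channel. Then this integral converges, and there are real numbers $f_0,f_2,\dots,f_{2n}$ with $$\widetilde{\mathcal M}=\sum_{k=0}^n f_{2k}\,\mathcal P_{2k}.$$ Let $Q$ be drawn from $\mu$ and, given $Q$, let $x\in\{0,1\}^n$ be the outcome of measuring $\Lambda(U_Q|\mathbf 0\rangle\langle\mathbf 0|U_Q^\dagger)$ in the computational basis, so that $x$ has conditional probability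 $\langle x|\Lambda(U_Q|\mathbf 0\rangle\langle\mathbf 0|U_Q^\dagger)|x\rangle$; this defines a probability distribution of $(Q,x)$. Then for any such coefficients $f_{2k}$ and every $0\le k\le n$, $$\hat f_{2k}=\frac{2^n\,\langle\langle\mathbf 0|\,\mathcal P_{2k}\,\mathcal U_Q^\dagger\,|x\rangle\rangle}{\binom nk}$$ is an unbiased estimator of $f_{2k}$: it is integrable and $\mathbb E[\hat f_{2k}]=f_{2k}$. -/

import Mathlib

open MeasureTheory
open scoped Matrix ComplexOrder

noncomputable section

namespace FermionicShadow

/-! ### Operators on `n` qubits -/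

/-- Linear operators on the Hilbert space of `n` qubits, as matrices in the computational basis
`|x⟩`, `x ∈ {0,1}ⁿ`. -/
abbrev Op (n : ℕ) : Type := Matrix (Fin n → Fin 2) (Fin n → Fin 2) ℂ

/-- Superoperators: linear maps on operators. -/
abbrev SuperOp (n : ℕ) : Type := Op n →ₗ[ℂ] Op n

/-- The computational basis state `|x⟩⟨x|`. -/
def basisState {n : ℕ} (x : Fin n → Fin 2) : Op n := Matrix.single x x 1

/-- The Hilbert-Schmidt normalised operator `|O⟩⟩ = O / √(tr(O O†))`. -/
def superket {n : ℕ} (O : Op n) : Op n :=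
  ((Real.sqrt (O * Oᴴ).trace.re : ℝ) : ℂ)⁻¹ • O

/-- The linear functional `⟨⟨O|`, that is `A ↦ tr(O† A) / √(tr(O O†))`. -/
def superbra {n : ℕ} (O : Op n) : Op n →ₗ[ℂ] ℂ :=
  Matrix.traceLinearMap (Fin n → Fin 2) ℂ ℂ ∘ₗ LinearMap.mulLeft ℂ (superket O)ᴴ

/-- The superoperator `|O⟩⟩⟨⟨O|`. -/
def superproj {n : ℕ} (O : Op n) : SuperOp n := (superbra O).smulRight (superket O)

/-- The channel `A ↦ U A U†`. -/
def unitaryChannel {n : ℕ} (U : Op n) : SuperOp n :=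
  LinearMap.mulLeft ℂ U ∘ₗ LinearMap.mulRight ℂ Uᴴ

/-- The measurement channel in the computational basis, `𝒳 = ∑ₓ |x⟩⟩⟨⟨x|`. -/
def measurementChannel (n : ℕ) : SuperOp n :=
  ∑ x : Fin n → Fin 2, superproj (basisState x)

/-- The map `id_m ⊗ Λ` on `m × m` block matrices with blocks in `Op n`. -/
def ampliation {n : ℕ} (Λ : SuperOp n) (m : ℕ)
    (M : Matrix (Fin m × (Fin n → Fin 2)) (Fin m × (Fin n → Fin 2)) ℂ) :
    Matrix (Fin m × (Fin n → Fin 2)) (Fin m × (Fin n → Fin 2)) ℂ :=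
  Matrix.of fun p q => Λ (Matrix.of fun i j => M (p.1, i) (q.1, j)) p.2 q.2

/-- Quantum channels: completely positive trace-preserving linear maps. -/
structure IsQuantumChannel {n : ℕ} (Λ : SuperOp n) : Prop where
  completely_positive : ∀ (m : ℕ)
    (M : Matrix (Fin m × (Fin n → Fin 2)) (Fin m × (Fin n → Fin 2)) ℂ),
    M.PosSemidef → (ampliation Λ m M).PosSemidef
  trace_preserving : ∀ A : Op n, (Λ A).trace = A.trace

/-! ### Majorana operators -/

/-- The sign `(-1)^(x₀ + ⋯ + x_{j-1})`. -/
def jwSign {n : ℕ} (j : Fin n) (x : Fin n → Fin 2) : ℂ :=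
  (-1) ^ (∑ i ∈ Finset.univ.filter (· < j), (x i : ℕ))

/-- The fermionic annihilation operator of mode `j` in the occupation number basis:
`b_j |x⟩ = (-1)^(x₀ + ⋯ + x_{j-1}) |x with x_j replaced by 0⟩` if `x_j = 1`,
and `b_j |x⟩ = 0` if `x_j = 0`. -/
def annihilation {n : ℕ} (j : Fin n) : Op n :=
  Matrix.of fun y x => if x j = 1 ∧ y = Function.update x j 0 then jwSign j x else 0

/-- The mode to which a Majorana operator belongs. -/
def mode {n : ℕ} (u : Fin (2 * n)) : Fin n := ⟨(u : ℕ) / 2, by have := u.isLt; omega⟩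

/-- The `2n` Majorana operators. Counting from zero, those of mode `j` are
`γ_{2j} = b_j + b_j†` and `γ_{2j+1} = -i (b_j - b_j†)`. -/
def majorana {n : ℕ} (u : Fin (2 * n)) : Op n :=
  if (u : ℕ) % 2 = 0 then annihilation (mode u) + (annihilation (mode u))ᴴ
  else (-Complex.I) • (annihilation (mode u) - (annihilation (mode u))ᴴ)

/-- The product `γ_S` of the Majorana operators indexed by `S`, in increasing order. -/
def majoranaProd {n : ℕ} (S : Finset (Fin (2 * n))) : Op n :=
  ((S.sort (· ≤ ·)).map majorana).prod

/-- The projector `𝒫_k = ∑_{|S| = k} |γ_S⟩⟩⟨⟨γ_S|` onto the span of the Majorana products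
of degree `k`. -/
def majoranaProjector (n k : ℕ) : SuperOp n :=
  ∑ S ∈ (Finset.univ : Finset (Fin (2 * n))).powersetCard k, superproj (majoranaProd S)

/-! ### Canonical anticommutation relations -/

/-- Flip the bit `j`. -/
def flipBit {n : ℕ} (x : Fin n → Fin 2) (j : Fin n) : Fin n → Fin 2 :=
  Function.update x j (1 - x j)

/-- The nonzero entry of a Majorana operator in the column `x`. -/
def majoranaPhase {n : ℕ} (u : Fin (2 * n)) (x : Fin n → Fin 2) : ℂ :=
  jwSign (mode u) x *
    (if (u : ℕ) % 2 = 0 then 1 else if x (mode u) = 0 then Complex.I else -Complex.I)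

theorem jwSign_flipBit_of_lt {n : ℕ} {i j : Fin n} (h : i < j) (x : Fin n → Fin 2) :
    jwSign j (flipBit x i) = - jwSign j x := by
  have hi : i ∈ Finset.univ.filter (· < j) := by simpa using h
  unfold jwSign
  rw [← Finset.add_sum_erase _ _ hi, ← Finset.add_sum_erase _ _ hi]
  have : ∑ a ∈ (Finset.univ.filter (· < j)).erase i, (flipBit x i a : ℕ)
      = ∑ a ∈ (Finset.univ.filter (· < j)).erase i, (x a : ℕ) := by
    refine Finset.sum_congr rfl fun a ha => ?_
    rw [flipBit, Function.update_of_ne (Finset.ne_of_mem_erase ha)]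
  rw [this, pow_add, pow_add, flipBit, Function.update_self]
  have : x i = 0 ∨ x i = 1 := by omega
  rcases this with h | h <;> simp [h]

theorem jwSign_flipBit_of_le {n : ℕ} {i j : Fin n} (h : j ≤ i) (x : Fin n → Fin 2) :
    jwSign j (flipBit x i) = jwSign j x := by
  unfold jwSign
  congr 1
  refine Finset.sum_congr rfl fun a ha => ?_
  have ha : a < j := by simpa using ha
  rw [flipBit, Function.update_of_ne (ha.trans_le h).ne]

theorem jwSign_mul_self {n : ℕ} (j : Fin n) (x : Fin n → Fin 2) :
    jwSign j x * jwSign j x = 1 := by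
  rw [jwSign, ← mul_pow]; simp

theorem star_jwSign {n : ℕ} (j : Fin n) (x : Fin n → Fin 2) :
    star (jwSign j x) = jwSign j x := by
  simp [jwSign]

theorem flipBit_flipBit {n : ℕ} (x : Fin n → Fin 2) (j : Fin n) :
    flipBit (flipBit x j) j = x := by
  simp [flipBit]

theorem flipBit_comm {n : ℕ} (x : Fin n → Fin 2) (i j : Fin n) :
    flipBit (flipBit x i) j = flipBit (flipBit x j) i := by
  rcases eq_or_ne i j with rfl | h
  · rfl
  · rw [flipBit, flipBit, flipBit, flipBit, Function.update_of_ne h, Function.update_of_ne h.symm,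
      Function.update_comm h]

theorem majorana_apply {n : ℕ} (u : Fin (2 * n)) (y x : Fin n → Fin 2) :
    majorana u y x = if y = flipBit x (mode u) then majoranaPhase u x else 0 := by
  have key : (annihilation (mode u))ᴴ y x =
      if x (mode u) = 0 ∧ y = flipBit x (mode u) then jwSign (mode u) x else 0 := by
    rw [Matrix.conjTranspose_apply, annihilation, Matrix.of_apply]
    by_cases h : x (mode u) = 0 ∧ y = flipBit x (mode u)
    · rw [if_pos h, if_pos, star_jwSign, h.2, jwSign_flipBit_of_le le_rfl]
      rw [h.2]
      refine ⟨by simp [flipBit, h.1], ?_⟩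
      simp [flipBit, ← h.1]
    · rw [if_neg h, if_neg, star_zero]
      rintro ⟨h1, h2⟩
      apply h
      rw [h2]
      refine ⟨by simp, ?_⟩
      simp [flipBit, ← h1]
  have key2 : (annihilation (mode u)) y x =
      if x (mode u) = 1 ∧ y = flipBit x (mode u) then jwSign (mode u) x else 0 := by
    rw [annihilation, Matrix.of_apply]
    congr 1
    by_cases h : x (mode u) = 1 <;> simp [flipBit, h]
  have hx : x (mode u) = 0 ∨ x (mode u) = 1 := by omega
  unfold majorana majoranaPhase
  by_cases hu : (u : ℕ) % 2 = 0
  · rw [if_pos hu, if_pos hu, Matrix.add_apply, key, key2]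
    by_cases hy : y = flipBit x (mode u) <;> rcases hx with hx | hx <;> simp [hx, hy]
  · rw [if_neg hu, if_neg hu, Matrix.smul_apply, Matrix.sub_apply, key, key2]
    by_cases hy : y = flipBit x (mode u) <;> rcases hx with hx | hx <;> simp [hx, hy, mul_comm]

theorem majorana_mul_apply {n : ℕ} (u v : Fin (2 * n)) (y x : Fin n → Fin 2) :
    (majorana u * majorana v) y x = if y = flipBit (flipBit x (mode v)) (mode u) then
      majoranaPhase u (flipBit x (mode v)) * majoranaPhase v x else 0 := by
  rw [Matrix.mul_apply, Finset.sum_eq_single (flipBit x (mode v))]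
  · simp [majorana_apply]
  · intro z _ hz
    simp [majorana_apply, hz]
  · simp

theorem majoranaPhase_flipBit_of_ne {n : ℕ} (u v : Fin (2 * n)) (h : mode u ≠ mode v)
    (x : Fin n → Fin 2) :
    majoranaPhase u (flipBit x (mode v)) =
      (if mode v < mode u then -1 else 1) * majoranaPhase u x := by
  have : flipBit x (mode v) (mode u) = x (mode u) := by
    rw [flipBit, Function.update_of_ne h]
  rw [majoranaPhase, majoranaPhase, this]
  by_cases h1 : mode v < mode u
  · rw [jwSign_flipBit_of_lt h1, if_pos h1]; ring
  · rw [jwSign_flipBit_of_le (not_lt.1 h1), if_neg h1]; ring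

/-- The canonical anticommutation relations `γ_u γ_v + γ_v γ_u = 2 δ_{uv}`. -/
theorem majorana_anticomm {n : ℕ} (u v : Fin (2 * n)) :
    majorana u * majorana v + majorana v * majorana u = if u = v then 2 else 0 := by
  ext y x
  rw [Matrix.add_apply, majorana_mul_apply, majorana_mul_apply, flipBit_comm x (mode u) (mode v)]
  by_cases hm : mode u = mode v
  · have hf : flipBit x (mode v) (mode v) = 1 - x (mode v) := by simp [flipBit]
    have hs := jwSign_mul_self (mode v) x
    have hx : x (mode v) = 0 ∨ x (mode v) = 1 := by omega
    have huv : u = v ↔ (u : ℕ) % 2 = (v : ℕ) % 2 := by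
      have : (u : ℕ) / 2 = (v : ℕ) / 2 := congrArg Fin.val hm
      rw [Fin.ext_iff]; omega
    simp only [majoranaPhase, hm, jwSign_flipBit_of_le le_rfl, hf, flipBit_flipBit]
    have hI := Complex.I_mul_I
    have h2 : (2 : Op n) y x = if y = x then 2 else 0 := by
      rw [← Matrix.diagonal_ofNat', Matrix.diagonal_apply]
      split_ifs <;> simp
    have hu2 : (u : ℕ) % 2 = 0 ∨ (u : ℕ) % 2 = 1 := by omega
    have hv2 : (v : ℕ) % 2 = 0 ∨ (v : ℕ) % 2 = 1 := by omega
    by_cases hy : y = x <;> rcases hx with hx | hx <;> rcases hu2 with hu | hu <;>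
      rcases hv2 with hv | hv <;> simp [huv, hu, hv, hx, hy, h2] <;>
      first
      | ring1
      | linear_combination (2 : ℂ) * hs
      | linear_combination (-2 * Complex.I * Complex.I) * hs - 2 * hI
  · have huv : u ≠ v := fun h => hm (by rw [h])
    rw [majoranaPhase_flipBit_of_ne u v hm, majoranaPhase_flipBit_of_ne v u (Ne.symm hm), if_neg huv]
    rcases lt_or_gt_of_ne hm with h | h
    · simp [h, h.not_gt]; split_ifs <;> ring
    · simp [h, h.not_gt]; split_ifs <;> ring

theorem majorana_conjTranspose {n : ℕ} (u : Fin (2 * n)) : (majorana u)ᴴ = majorana u := by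
  unfold majorana
  split_ifs
  · simp [add_comm]
  · simp [Matrix.conjTranspose_smul, smul_sub]
    abel

/-! ### Fermionic Gaussian unitaries (matchgates) -/

/-- `U` is a fermionic Gaussian unitary for `Q`, that is, `U† γ_u U = ∑_v Q_{uv} γ_v`. -/
def IsGaussianUnitary {n : ℕ} (Q : Matrix (Fin (2 * n)) (Fin (2 * n)) ℝ) (U : Op n) : Prop :=
  U ∈ Matrix.unitaryGroup (Fin n → Fin 2) ℂ ∧
    ∀ u, Uᴴ * majorana u * U = ∑ v, (Q u v : ℂ) • majorana v

/-- Real linear combinations of the Majorana operators. -/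
def majoranaVec {n : ℕ} : EuclideanSpace ℝ (Fin (2 * n)) →ₗ[ℝ] Op n where
  toFun w := ∑ v, ((w v : ℝ) : ℂ) • majorana v
  map_add' w w' := by simp [add_smul, Finset.sum_add_distrib]
  map_smul' a w := by
    rw [Finset.smul_sum]
    refine Finset.sum_congr rfl fun v _ => ?_
    ext i j
    simp [mul_assoc]

theorem majoranaVec_apply {n : ℕ} (w : EuclideanSpace ℝ (Fin (2 * n))) :
    majoranaVec w = ∑ v, ((w v : ℝ) : ℂ) • majorana v := rfl

theorem majoranaVec_anticomm {n : ℕ} (w w' : EuclideanSpace ℝ (Fin (2 * n))) :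
    majoranaVec w * majoranaVec w' + majoranaVec w' * majoranaVec w =
      (2 * inner ℝ w w' : ℝ) • (1 : Op n) := by
  have h1 : majoranaVec w' * majoranaVec w =
      ∑ u, ∑ v, ((w u : ℂ) * (w' v : ℂ)) • (majorana v * majorana u) := by
    rw [majoranaVec_apply, majoranaVec_apply, Finset.sum_mul_sum, Finset.sum_comm]
    refine Finset.sum_congr rfl fun u _ => Finset.sum_congr rfl fun v _ => ?_
    rw [smul_mul_smul_comm, mul_comm]
  have h2 : majoranaVec w * majoranaVec w' =
      ∑ u, ∑ v, ((w u : ℂ) * (w' v : ℂ)) • (majorana u * majorana v) := by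
    rw [majoranaVec_apply, majoranaVec_apply, Finset.sum_mul_sum]
    refine Finset.sum_congr rfl fun u _ => Finset.sum_congr rfl fun v _ => ?_
    rw [smul_mul_smul_comm]
  rw [h1, h2, ← Finset.sum_add_distrib]
  simp_rw [← Finset.sum_add_distrib, ← smul_add, majorana_anticomm]
  have h3 : (2 : Op n) = (2 : ℂ) • (1 : Op n) := by
    rw [two_smul, one_add_one_eq_two]
  simp only [smul_ite, smul_zero, Finset.sum_ite_eq, Finset.mem_univ, if_true, h3, smul_smul,
    ← Finset.sum_smul, PiLp.inner_apply]
  ext i j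
  simp [Finset.mul_sum, mul_comm]

theorem majoranaVec_conjTranspose {n : ℕ} (w : EuclideanSpace ℝ (Fin (2 * n))) :
    (majoranaVec w)ᴴ = majoranaVec w := by
  simp [majoranaVec_apply, Matrix.conjTranspose_sum, Matrix.conjTranspose_smul,
    majorana_conjTranspose]

/-- The fermion parity operator. -/
def parity (n : ℕ) : Op n := Matrix.diagonal fun x => (-1) ^ (∑ i, (x i : ℕ))

theorem parity_conjTranspose (n : ℕ) : (parity n)ᴴ = parity n := by
  rw [parity, Matrix.diagonal_conjTranspose]
  congr 1
  ext x
  simp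

theorem parity_mul_self (n : ℕ) : parity n * parity n = 1 := by
  rw [parity, Matrix.diagonal_mul_diagonal]
  simp [← mul_pow]

theorem parity_mul_majorana {n : ℕ} (u : Fin (2 * n)) :
    parity n * majorana u = - (majorana u * parity n) := by
  ext y x
  rw [parity, Matrix.diagonal_mul, Matrix.neg_apply, Matrix.mul_diagonal, majorana_apply]
  split_ifs with h
  · have hs : (-1 : ℂ) ^ (∑ i, (y i : ℕ)) = - (-1) ^ (∑ i, (x i : ℕ)) := by
      rw [h, ← Finset.add_sum_erase _ _ (Finset.mem_univ (mode u)),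
        ← Finset.add_sum_erase _ (fun i => (x i : ℕ)) (Finset.mem_univ (mode u))]
      have : ∑ a ∈ Finset.univ.erase (mode u), (flipBit x (mode u) a : ℕ)
          = ∑ a ∈ Finset.univ.erase (mode u), (x a : ℕ) := by
        refine Finset.sum_congr rfl fun a ha => ?_
        rw [flipBit, Function.update_of_ne (Finset.ne_of_mem_erase ha)]
      rw [this, pow_add, pow_add, flipBit, Function.update_self]
      have : x (mode u) = 0 ∨ x (mode u) = 1 := by omega
      rcases this with h | h <;> simp [h]
    rw [hs]; ring
  · simp

theorem parity_mul_majoranaVec {n : ℕ} (w : EuclideanSpace ℝ (Fin (2 * n))) :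
    parity n * majoranaVec w = - (majoranaVec w * parity n) := by
  simp [majoranaVec_apply, Finset.mul_sum, Finset.sum_mul, parity_mul_majorana]

/-- Every linear isometry of the real span of the Majorana operators is implemented by conjugation
with a unitary. -/
theorem exists_unitary_of_isometry {n : ℕ}
    (φ : EuclideanSpace ℝ (Fin (2 * n)) ≃ₗᵢ[ℝ] EuclideanSpace ℝ (Fin (2 * n))) :
    ∃ U ∈ Matrix.unitaryGroup (Fin n → Fin 2) ℂ,
      ∀ w, Uᴴ * majoranaVec w * U = majoranaVec (φ w) := by
  have hφ : φ ∈ (⊤ : Subgroup (EuclideanSpace ℝ (Fin (2 * n)) ≃ₗᵢ[ℝ]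
      EuclideanSpace ℝ (Fin (2 * n)))) := trivial
  rw [← LinearIsometryEquiv.reflections_generate] at hφ
  induction hφ using Subgroup.closure_induction with
  | mem φ h =>
    obtain ⟨v, rfl⟩ := h
    rcases eq_or_ne v 0 with rfl | hv
    · refine ⟨1, one_mem _, fun w => ?_⟩
      have : ((ℝ ∙ (0 : EuclideanSpace ℝ (Fin (2 * n))))ᗮ.reflection) w = w := by
        rw [Submodule.reflection_orthogonal_apply, Submodule.reflection_singleton_apply]
        simp
      simp only [this]
      simp
    · have hn : ‖v‖ ≠ 0 := norm_ne_zero_iff.2 hv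
      set e := (‖v‖⁻¹ : ℝ) • v with he
      have hee : majoranaVec e * majoranaVec e = 1 := by
        have h := majoranaVec_anticomm e e
        have h1 : inner ℝ e e = (1 : ℝ) := by
          rw [real_inner_self_eq_norm_sq, he, norm_smul, norm_inv, norm_norm,
            inv_mul_cancel₀ hn, one_pow]
        rw [h1, ← two_smul ℝ (majoranaVec e * majoranaVec e), mul_one] at h
        exact smul_right_injective _ (two_ne_zero' ℝ) h
      have hstar : (majoranaVec e * parity n)ᴴ = parity n * majoranaVec e := by
        rw [Matrix.conjTranspose_mul, parity_conjTranspose, majoranaVec_conjTranspose]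
      refine ⟨majoranaVec e * parity n, ?_, fun w => ?_⟩
      · rw [Matrix.mem_unitaryGroup_iff, Matrix.star_eq_conjTranspose, hstar,
          mul_assoc, ← mul_assoc (parity n), parity_mul_self, one_mul, hee]
      · have h1 := majoranaVec_anticomm e w
        have h2 : ((ℝ ∙ v)ᗮ.reflection) w = w - (2 * inner ℝ e w) • e := by
          rw [Submodule.reflection_orthogonal_apply, Submodule.reflection_singleton_apply, he,
            inner_smul_left, smul_smul]
          simp only [neg_sub, two_smul, conj_trivial, RCLike.ofReal_real_eq_id, id,
            ← add_smul]
          congr 2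
          field_simp
          ring
        have h3 : majoranaVec e * majoranaVec w * majoranaVec e =
            majoranaVec ((2 * inner ℝ e w) • e - w) := by
          rw [eq_sub_of_add_eq h1, sub_mul, mul_assoc, hee, mul_one, map_sub,
            (majoranaVec (n := n)).map_smul (2 * inner ℝ e w) e, smul_mul_assoc, one_mul]
        simp only [h2]
        rw [hstar]
        calc parity n * majoranaVec e * majoranaVec w * (majoranaVec e * parity n)
            = parity n * (majoranaVec e * majoranaVec w * majoranaVec e) * parity n := by
              simp only [mul_assoc]
          _ = _ := by
              rw [h3, parity_mul_majoranaVec, neg_mul, mul_assoc, parity_mul_self, mul_one,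
                ← map_neg, neg_sub]
  | one => exact ⟨1, one_mem _, fun w => by simp⟩
  | mul φ ψ _ _ h1 h2 =>
    obtain ⟨U, hU, hU'⟩ := h1
    obtain ⟨V, hV, hV'⟩ := h2
    refine ⟨V * U, mul_mem hV hU, fun w => ?_⟩
    rw [Matrix.conjTranspose_mul]
    calc Uᴴ * Vᴴ * majoranaVec w * (V * U) = Uᴴ * (Vᴴ * majoranaVec w * V) * U := by
          simp only [mul_assoc]
      _ = _ := by rw [hV', hU']; rfl
  | inv φ _ h =>
    obtain ⟨U, hU, hU'⟩ := h
    refine ⟨Uᴴ, Unitary.star_mem hU, fun w => ?_⟩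
    have h1 : U * Uᴴ = 1 := Matrix.mem_unitaryGroup_iff.1 hU
    have h2 : majoranaVec w = majoranaVec (φ (φ⁻¹ w)) := by
      congr 1; exact (φ.apply_symm_apply w).symm
    rw [h2, ← hU', Matrix.conjTranspose_conjTranspose]
    calc U * (Uᴴ * majoranaVec (φ⁻¹ w) * U) * Uᴴ
        = (U * Uᴴ) * majoranaVec (φ⁻¹ w) * (U * Uᴴ) := by simp only [mul_assoc]
      _ = _ := by rw [h1, one_mul, mul_one]

/-- Every orthogonal matrix has a fermionic Gaussian unitary. -/
theorem exists_isGaussianUnitary {n : ℕ} (Q : Matrix.orthogonalGroup (Fin (2 * n)) ℝ) :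
    ∃ U : Op n, IsGaussianUnitary Q.1 U := by
  have hQ : Q.1 * Q.1ᵀ = 1 := (Matrix.mem_orthogonalGroup_iff _ _).1 Q.2
  let f := Matrix.toEuclideanLin Q.1ᵀ
  have hf : ∀ x y, inner ℝ (f x) (f y) = inner ℝ x y := by
    intro x y
    simp only [f, EuclideanSpace.inner_eq_star_dotProduct, Matrix.ofLp_toLpLin, Matrix.toLin'_apply,
      star_trivial]
    rw [Matrix.dotProduct_mulVec, Matrix.vecMul_transpose, Matrix.mulVec_mulVec, hQ,
      Matrix.one_mulVec]
  obtain ⟨U, hU, hU'⟩ :=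
    exists_unitary_of_isometry ((f.isometryOfInner hf).toLinearIsometryEquiv rfl)
  refine ⟨U, hU, fun u => ?_⟩
  have h := hU' (EuclideanSpace.single u 1)
  have h1 : majoranaVec (EuclideanSpace.single u 1) = majorana u := by
    simp [majoranaVec_apply]
  rw [h1] at h
  rw [h, majoranaVec_apply]
  refine Finset.sum_congr rfl fun v _ => ?_
  simp [f, Matrix.ofLp_toLpLin]

/-- The Gaussian unitary (matchgate) `U_Q` of an orthogonal matrix `Q`. It is determined by `Q` up
to a global phase, which does not affect the channel `𝒰_Q`. -/
def gaussianUnitary {n : ℕ} (Q : Matrix.orthogonalGroup (Fin (2 * n)) ℝ) : Op n :=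
  (exists_isGaussianUnitary Q).choose

theorem gaussianUnitary_spec {n : ℕ} (Q : Matrix.orthogonalGroup (Fin (2 * n)) ℝ) :
    IsGaussianUnitary Q.1 (gaussianUnitary Q) :=
  (exists_isGaussianUnitary Q).choose_spec

/-! ### The Haar probability measure on the orthogonal group -/

instance orthogonalGroup_measurableSpace (m : ℕ) :
    MeasurableSpace (Matrix.orthogonalGroup (Fin m) ℝ) := borel _

instance orthogonalGroup_borelSpace (m : ℕ) :
    BorelSpace (Matrix.orthogonalGroup (Fin m) ℝ) := ⟨rfl⟩

instance orthogonalGroup_compactSpace (m : ℕ) :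
    CompactSpace (Matrix.orthogonalGroup (Fin m) ℝ) := by
  refine isCompact_iff_compactSpace.1 ?_
  have hK : IsCompact (Set.pi Set.univ fun _ => Set.pi Set.univ fun _ => Set.Icc (-1) 1 :
      Set (Matrix (Fin m) (Fin m) ℝ)) :=
    isCompact_univ_pi fun _ => isCompact_univ_pi fun _ => isCompact_Icc
  refine hK.of_isClosed_subset ?_ ?_
  · have : ((Matrix.orthogonalGroup (Fin m) ℝ : Submonoid _) : Set (Matrix (Fin m) (Fin m) ℝ)) =
        {A | A * Aᵀ = 1} := by
      ext A; exact Matrix.mem_orthogonalGroup_iff _ _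
    rw [this]
    exact isClosed_eq (by fun_prop) continuous_const
  · intro A hA i _ j _
    have h := entry_norm_bound_of_unitary (𝕜 := ℝ) hA i j
    exact abs_le.1 h

/-- The normalised Haar measure on the orthogonal group. -/
def orthogonalHaar (m : ℕ) : Measure (Matrix.orthogonalGroup (Fin m) ℝ) :=
  Measure.haarMeasure ⊤

/-! ### The noisy shadow channel and the calibration estimator -/

/-- The superoperator `𝒰_Q† ∘ 𝒳 ∘ Λ ∘ 𝒰_Q`. -/
def noisyShadowIntegrand {n : ℕ} (Λ : SuperOp n) (Q : Matrix.orthogonalGroup (Fin (2 * n)) ℝ) :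
    SuperOp n :=
  unitaryChannel (gaussianUnitary Q)ᴴ ∘ₗ measurementChannel n ∘ₗ Λ ∘ₗ
    unitaryChannel (gaussianUnitary Q)

/-- The noisy fermionic shadow channel `ℳ̃ = ∫ 𝒰_Q† 𝒳 Λ 𝒰_Q dμ(Q)`. -/
def noisyShadowChannel {n : ℕ} (Λ : SuperOp n) (A : Op n) : Op n :=
  Matrix.of fun i j => ∫ Q, noisyShadowIntegrand Λ Q A i j ∂(orthogonalHaar (2 * n))

/-- The probability `⟨x| Λ(U_Q |0⟩⟨0| U_Q†) |x⟩` of the outcome `x` when the noisy circuit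
`Λ ∘ 𝒰_Q` is applied to `|0⟩⟨0|` and the result is measured in the computational basis. -/
def outcomeProb {n : ℕ} (Λ : SuperOp n) (Q : Matrix.orthogonalGroup (Fin (2 * n)) ℝ)
    (x : Fin n → Fin 2) : ℝ :=
  (Λ (unitaryChannel (gaussianUnitary Q) (basisState 0)) x x).re

/-- The joint law of the random orthogonal matrix `Q`, drawn from the Haar measure, and of the
measurement outcome `x`, which has the conditional probabilities `outcomeProb Λ Q x`. -/
def calibrationLaw {n : ℕ} (Λ : SuperOp n) :
    Measure (Matrix.orthogonalGroup (Fin (2 * n)) ℝ × (Fin n → Fin 2)) :=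
  ∑ x : Fin n → Fin 2,
    ((orthogonalHaar (2 * n)).withDensity fun Q => ENNReal.ofReal (outcomeProb Λ Q x)).map
      fun Q => (Q, x)

/-- The estimator `2ⁿ ⟨⟨0| 𝒫_{2k} 𝒰_Q† |x⟩⟩ / C(n, k)`. -/
def calibrationEstimator {n : ℕ} (k : ℕ)
    (s : Matrix.orthogonalGroup (Fin (2 * n)) ℝ × (Fin n → Fin 2)) : ℂ :=
  2 ^ n * superbra (basisState 0) (majoranaProjector n (2 * k)
    (unitaryChannel (gaussianUnitary s.1)ᴴ (superket (basisState s.2)))) / (n.choose k : ℂ)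

/-- The decomposition `ℳ̃ = ∑_{k=0}^n f_{2k} 𝒫_{2k}`; here `f k` stands for `f_{2k}`. -/
def IsDecomposition {n : ℕ} (Λ : SuperOp n) (f : Fin (n + 1) → ℝ) : Prop :=
  ∀ A : Op n, noisyShadowChannel Λ A =
    ∑ k : Fin (n + 1), (f k : ℂ) • majoranaProjector n (2 * (k : ℕ)) A

end FermionicShadow

end

open FermionicShadow

noncomputable section

namespace FermionicShadow

variable {n : ℕ}

/-! ### Conjugation by a Gaussian unitary -/

/-! Conjugation `heisenberg Q` is an algebra automorphism determined by its values on the Majorana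
generators. The arbitrary phase of `gaussianUnitary Q` therefore drops out, composition follows
multiplication in the orthogonal group up to order (`heisenberg_comp`), and each image is polynomial
in the entries of Q. Hence every integrand is continuous on a compact group, and the integrals
exist.

Right invariance of Haar measure makes the averaged channel commute with all these automorphisms
(`noisyShadowMap_heisenberg`). Coordinate reflections act on the products γ_S by sign patterns that
separate the sets S, and the γ_S form a basis, so each γ_S is an eigenvector. Permutation matrices
make the eigenvalue depend on |S| only; compatibility with adjoints makes it real; the parity
operator kills odd |S|, because odd products have zero diagonal and measurement sees only diagonals.
This is the decomposition.

For the estimator, weighting by the outcome probabilities reassembles the channel integrand at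
|0⟩⟨0|. The expectation is thus a fixed linear functional of the averaged channel at |0⟩⟨0|, namely
f_{2k} · 2ⁿ ⟨⟨0|𝒫_{2k}|0⟩⟩ / C(n,k). The factor multiplying f_{2k} is 1: γ_S has unimodular diagonal
entries when S is a union of full mode pairs and zero diagonal otherwise, and C(n,k) such sets have
size 2k (`majoranaProjector_basisState_apply_self`). -/

theorem unitaryChannel_apply (U A : Op n) : unitaryChannel U A = U * A * Uᴴ := by
  simp [unitaryChannel, mul_assoc]

theorem gaussianUnitary_mul_conjTranspose (Q : Matrix.orthogonalGroup (Fin (2 * n)) ℝ) :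
    gaussianUnitary Q * (gaussianUnitary Q)ᴴ = 1 :=
  Matrix.mem_unitaryGroup_iff.1 (gaussianUnitary_spec Q).1

theorem gaussianUnitary_conjTranspose_mul (Q : Matrix.orthogonalGroup (Fin (2 * n)) ℝ) :
    (gaussianUnitary Q)ᴴ * gaussianUnitary Q = 1 :=
  Matrix.mem_unitaryGroup_iff'.1 (gaussianUnitary_spec Q).1

/-- The automorphism `A ↦ U_Q† A U_Q` of the operator algebra. -/
def heisenberg (Q : Matrix.orthogonalGroup (Fin (2 * n)) ℝ) : Op n →ₐ[ℂ] Op n :=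
  AlgHom.ofLinearMap (unitaryChannel (gaussianUnitary Q)ᴴ)
    (by simp [unitaryChannel_apply, gaussianUnitary_conjTranspose_mul])
    (fun A B => by
      simp only [unitaryChannel_apply, Matrix.conjTranspose_conjTranspose]
      calc _ = (gaussianUnitary Q)ᴴ * A * 1 * B * gaussianUnitary Q := by simp only [mul_assoc, one_mul]
        _ = _ := by rw [← gaussianUnitary_mul_conjTranspose Q]; simp only [mul_assoc])

theorem heisenberg_apply (Q : Matrix.orthogonalGroup (Fin (2 * n)) ℝ) (A : Op n) :
    heisenberg Q A = (gaussianUnitary Q)ᴴ * A * gaussianUnitary Q := by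
  simp [heisenberg, unitaryChannel_apply]

theorem unitaryChannel_conjTranspose_eq (Q : Matrix.orthogonalGroup (Fin (2 * n)) ℝ) (A : Op n) :
    unitaryChannel (gaussianUnitary Q)ᴴ A = heisenberg Q A := rfl

theorem heisenberg_majorana (Q : Matrix.orthogonalGroup (Fin (2 * n)) ℝ) (u : Fin (2 * n)) :
    heisenberg Q (majorana u) = ∑ v, (Q.1 u v : ℂ) • majorana v := by
  rw [heisenberg_apply, (gaussianUnitary_spec Q).2]

theorem trace_heisenberg (Q : Matrix.orthogonalGroup (Fin (2 * n)) ℝ) (A : Op n) :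
    (heisenberg Q A).trace = A.trace := by
  rw [heisenberg_apply, Matrix.trace_mul_cycle, gaussianUnitary_mul_conjTranspose, one_mul]

theorem heisenberg_conjTranspose (Q : Matrix.orthogonalGroup (Fin (2 * n)) ℝ) (A : Op n) :
    heisenberg Q Aᴴ = (heisenberg Q A)ᴴ := by
  simp [heisenberg_apply, Matrix.conjTranspose_mul, mul_assoc]

/-! ### Reflections and permutations of the Majorana operators -/

/-- The reflection of `ℝ²ⁿ` that changes the sign of the coordinate `u`. -/
def coordReflection {m : ℕ} (u : Fin m) : Matrix.orthogonalGroup (Fin m) ℝ :=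
  ⟨Matrix.diagonal fun v => if v = u then -1 else 1, by
    rw [Matrix.mem_orthogonalGroup_iff, Matrix.diagonal_transpose, Matrix.diagonal_mul_diagonal,
      ← Matrix.diagonal_one]
    congr 1
    ext v
    split_ifs <;> simp⟩

/-- The permutation matrix of `σ`. -/
def coordPermutation {m : ℕ} (σ : Equiv.Perm (Fin m)) : Matrix.orthogonalGroup (Fin m) ℝ :=
  ⟨Matrix.of fun u v => if σ u = v then 1 else 0, by
    rw [Matrix.mem_orthogonalGroup_iff]
    ext u v
    simp [Matrix.mul_apply, Matrix.one_apply, eq_comm]⟩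

theorem heisenberg_coordReflection_majorana (u v : Fin (2 * n)) :
    heisenberg (coordReflection u) (majorana v) = (if v = u then -1 else 1 : ℂ) • majorana v := by
  rw [heisenberg_majorana, Finset.sum_eq_single v]
  · simp only [coordReflection, Matrix.diagonal_apply_eq]
    split_ifs <;> simp
  · intro w _ hw
    simp [coordReflection, Matrix.diagonal_apply_ne _ hw.symm]
  · simp

theorem heisenberg_coordPermutation_majorana (σ : Equiv.Perm (Fin (2 * n))) (v : Fin (2 * n)) :
    heisenberg (coordPermutation σ) (majorana v) = majorana (σ v) := by
  rw [heisenberg_majorana, Finset.sum_eq_single (σ v)]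
  · simp [coordPermutation]
  · intro w _ hw
    simp [coordPermutation, hw.symm]
  · simp

/-- Without repetitions the reflected generator occurs at most once, so at most one sign appears.
The list need not be sorted, which allows its use on permuted products. -/
theorem heisenberg_coordReflection_prod (u : Fin (2 * n)) {l : List (Fin (2 * n))} (hl : l.Nodup) :
    heisenberg (coordReflection u) (l.map majorana).prod =
      (if u ∈ l then -1 else 1 : ℂ) • (l.map majorana).prod := by
  induction l with
  | nil => simp
  | cons v l ih =>
    rw [List.nodup_cons] at hl
    rw [List.map_cons, List.prod_cons, map_mul, heisenberg_coordReflection_majorana, ih hl.2,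
      smul_mul_smul_comm]
    congr 1
    by_cases h : v = u
    · subst h; simp [hl.1]
    · simp [h, Ne.symm h]

theorem heisenberg_coordReflection_majoranaProd (u : Fin (2 * n)) (S : Finset (Fin (2 * n))) :
    heisenberg (coordReflection u) (majoranaProd S) =
      (if u ∈ S then -1 else 1 : ℂ) • majoranaProd S := by
  rw [majoranaProd, heisenberg_coordReflection_prod u (Finset.sort_nodup _ _)]
  simp

/-! ### The orthogonal basis of Majorana products -/

theorem majorana_mul_self (u : Fin (2 * n)) : majorana u * majorana u = 1 := by
  have h := majorana_anticomm u u
  rw [if_pos rfl, ← two_mul] at h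
  have h2 : (2 : Op n) = (2 : ℂ) • (1 : Op n) := by rw [two_smul, one_add_one_eq_two]
  rw [h2, smul_one_mul] at h
  refine smul_right_injective _ (two_ne_zero' ℂ) ?_
  simpa using h

theorem majoranaProd_conjTranspose_mul_self (S : Finset (Fin (2 * n))) :
    (majoranaProd S)ᴴ * majoranaProd S = 1 := by
  rw [majoranaProd]
  induction S.sort (· ≤ ·) with
  | nil => simp
  | cons u l ih =>
    rw [List.map_cons, List.prod_cons, Matrix.conjTranspose_mul, majorana_conjTranspose, mul_assoc,
      ← mul_assoc (majorana u), majorana_mul_self, one_mul, ih]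

theorem trace_one_op : (1 : Op n).trace = 2 ^ n := by
  simp [Matrix.trace_one]

/-- An operator with the reflection signs of `T` is orthogonal to `γ_S` for `S ≠ T`. -/
theorem trace_majoranaProd_mul_eq_zero {S T : Finset (Fin (2 * n))} (hST : S ≠ T) {A : Op n}
    (hA : ∀ u, heisenberg (coordReflection u) A = (if u ∈ T then -1 else 1 : ℂ) • A) :
    ((majoranaProd S)ᴴ * A).trace = 0 := by
  -- Reflecting a coordinate in exactly one of S and T flips the sign of the product while
  -- preserving its trace, so the trace vanishes.
  obtain ⟨u, hu⟩ : ∃ u, ¬(u ∈ S ↔ u ∈ T) := by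
    by_contra! h
    exact hST (Finset.ext h)
  have h := trace_heisenberg (coordReflection u) ((majoranaProd S)ᴴ * A)
  rw [map_mul, heisenberg_conjTranspose, heisenberg_coordReflection_majoranaProd, hA] at h
  have h' : -((majoranaProd S)ᴴ * A).trace = ((majoranaProd S)ᴴ * A).trace := by
    rw [← h]
    by_cases h1 : u ∈ S <;> by_cases h2 : u ∈ T <;> simp_all
  exact self_eq_neg.1 h'.symm

theorem trace_majoranaProd_mul_majoranaProd (S T : Finset (Fin (2 * n))) :
    ((majoranaProd S)ᴴ * majoranaProd T).trace = if S = T then 2 ^ n else 0 := by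
  split_ifs with h
  · rw [h, majoranaProd_conjTranspose_mul_self, trace_one_op]
  · exact trace_majoranaProd_mul_eq_zero h fun u => heisenberg_coordReflection_majoranaProd u T

theorem linearIndependent_majoranaProd :
    LinearIndependent ℂ (majoranaProd : Finset (Fin (2 * n)) → Op n) := by
  rw [Fintype.linearIndependent_iff]
  intro c hc S
  have h : ((majoranaProd S)ᴴ * ∑ T, c T • majoranaProd T).trace = c S * 2 ^ n := by
    simp [Finset.mul_sum, Matrix.trace_sum, trace_majoranaProd_mul_majoranaProd]
  rw [hc] at h
  simpa using h.symm

theorem span_majoranaProd :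
    Submodule.span ℂ (Set.range (majoranaProd : Finset (Fin (2 * n)) → Op n)) = ⊤ := by
  refine linearIndependent_majoranaProd.span_eq_top_of_card_eq_finrank' ?_
  -- Both counts are 4ⁿ: subsets of 2n indices, and entries of a 2ⁿ × 2ⁿ matrix.
  simp [Module.finrank_matrix, pow_mul, ← pow_add, ← two_mul]

/-- The expansion of an operator in Majorana products. -/
theorem sum_majoranaProd (A : Op n) :
    ∑ S, ((2 ^ n)⁻¹ * ((majoranaProd S)ᴴ * A).trace) • majoranaProd S = A := by
  have hA : A ∈ Submodule.span ℂ (Set.range (majoranaProd : Finset (Fin (2 * n)) → Op n)) := by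
    rw [span_majoranaProd]; trivial
  obtain ⟨c, rfl⟩ := (Submodule.mem_span_range_iff_exists_fun ℂ).1 hA
  refine Finset.sum_congr rfl fun S _ => ?_
  congr 1
  simp only [Finset.mul_sum, Matrix.trace_sum, Matrix.mul_smul, Matrix.trace_smul, smul_eq_mul,
    trace_majoranaProd_mul_majoranaProd, mul_ite, mul_zero, Finset.sum_ite_eq, Finset.mem_univ,
    if_true]
  field_simp

/-- An operator with the reflection signs of `γ_S` is a multiple of `γ_S`. -/
theorem eq_smul_majoranaProd {S : Finset (Fin (2 * n))} {A : Op n}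
    (hA : ∀ u, heisenberg (coordReflection u) A = (if u ∈ S then -1 else 1 : ℂ) • A) :
    ∃ a : ℂ, A = a • majoranaProd S := by
  refine ⟨_, (sum_majoranaProd A).symm.trans (Finset.sum_eq_single S ?_ (by simp))⟩
  intro T _ hT
  rw [trace_majoranaProd_mul_eq_zero hT hA, mul_zero, zero_smul]

theorem majoranaProd_ne_zero (S : Finset (Fin (2 * n))) : majoranaProd S ≠ (0 : Op n) :=
  linearIndependent_majoranaProd.ne_zero S

theorem op_linearMap_ext {M : Type*} [AddCommMonoid M] [Module ℂ M] {f g : Op n →ₗ[ℂ] M}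
    (h : ∀ S, f (majoranaProd S) = g (majoranaProd S)) : f = g :=
  LinearMap.ext_on_range span_majoranaProd h

theorem adjoin_majorana : Algebra.adjoin ℂ (Set.range (majorana : Fin (2 * n) → Op n)) = ⊤ := by
  rw [← Algebra.toSubmodule_eq_top, ← top_le_iff, ← span_majoranaProd, Submodule.span_le]
  rintro _ ⟨S, rfl⟩
  refine Subalgebra.list_prod_mem _ fun A hA => ?_
  obtain ⟨u, -, rfl⟩ := List.mem_map.1 hA
  exact Algebra.subset_adjoin ⟨u, rfl⟩

theorem op_algHom_ext {f g : Op n →ₐ[ℂ] Op n} (h : ∀ u, f (majorana u) = g (majorana u)) :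
    f = g :=
  AlgHom.ext_of_adjoin_eq_top adjoin_majorana (by rintro _ ⟨u, rfl⟩; exact h u)

/-! ### Group law and continuity -/

/-- Compared on generators, where both sides are linear in the Majorana operators, so no phases
enter. The order is reversed: `heisenberg` is an antihomomorphism in Q. -/
theorem heisenberg_comp (Q R : Matrix.orthogonalGroup (Fin (2 * n)) ℝ) :
    (heisenberg R).comp (heisenberg Q) = heisenberg (Q * R) := by
  refine op_algHom_ext fun u => ?_
  simp only [AlgHom.comp_apply, heisenberg_majorana, map_sum, map_smul, Finset.smul_sum, smul_smul,
    Submonoid.coe_mul, Matrix.mul_apply]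
  rw [Finset.sum_comm]
  simp [Finset.sum_smul]

theorem heisenberg_heisenberg (Q R : Matrix.orthogonalGroup (Fin (2 * n)) ℝ) (A : Op n) :
    heisenberg R (heisenberg Q A) = heisenberg (Q * R) A := by
  rw [← heisenberg_comp]; rfl

theorem heisenberg_one : heisenberg (1 : Matrix.orthogonalGroup (Fin (2 * n)) ℝ) =
    AlgHom.id ℂ (Op n) := by
  refine op_algHom_ext fun u => ?_
  simp [heisenberg_majorana, Matrix.one_apply]

/-- Expresses both conjugations in the shadow channel through one family of automorphisms, so that
the group law applies to each. -/
theorem unitaryChannel_eq (Q : Matrix.orthogonalGroup (Fin (2 * n)) ℝ) (A : Op n) :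
    unitaryChannel (gaussianUnitary Q) A = heisenberg Q⁻¹ A := by
  have h : heisenberg Q (unitaryChannel (gaussianUnitary Q) A) = A := by
    rw [heisenberg_apply, unitaryChannel_apply]
    calc _ = ((gaussianUnitary Q)ᴴ * gaussianUnitary Q) * A *
          ((gaussianUnitary Q)ᴴ * gaussianUnitary Q) := by simp only [mul_assoc]
      _ = A := by rw [gaussianUnitary_conjTranspose_mul, one_mul, mul_one]
  calc _ = heisenberg Q⁻¹ (heisenberg Q (unitaryChannel (gaussianUnitary Q) A)) := by
        rw [heisenberg_heisenberg, mul_inv_cancel, heisenberg_one]; rfl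
    _ = _ := by rw [h]

theorem heisenberg_injective (Q : Matrix.orthogonalGroup (Fin (2 * n)) ℝ) :
    Function.Injective (heisenberg Q) := by
  intro A B h
  have := congrArg (heisenberg Q⁻¹) h
  simpa [heisenberg_heisenberg, heisenberg_one] using this

theorem heisenberg_majoranaProd (Q : Matrix.orthogonalGroup (Fin (2 * n)) ℝ)
    (S : Finset (Fin (2 * n))) : heisenberg Q (majoranaProd S) =
      ((S.sort (· ≤ ·)).map fun u => ∑ v, (Q.1 u v : ℂ) • majorana v).prod := by
  rw [majoranaProd, map_list_prod, List.map_map]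
  congr 2
  ext1 u
  exact heisenberg_majorana Q u

/-- The unitary itself is obtained by choice and need not depend continuously on Q; its conjugation
action does, since it sends each γ_S to a polynomial in the entries of Q. -/
theorem continuous_heisenberg (A : Op n) :
    Continuous fun Q : Matrix.orthogonalGroup (Fin (2 * n)) ℝ => heisenberg Q A := by
  rw [← sum_majoranaProd A]
  simp only [map_sum, map_smul, heisenberg_majoranaProd]
  have h (u v : Fin (2 * n)) :
      Continuous fun Q : Matrix.orthogonalGroup (Fin (2 * n)) ℝ => (Q.1 u v : ℂ) :=
    Complex.continuous_ofReal.comp (continuous_subtype_val.matrix_elem u v)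
  have h' (u : Fin (2 * n)) : Continuous fun Q : Matrix.orthogonalGroup (Fin (2 * n)) ℝ =>
      ∑ v, (Q.1 u v : ℂ) • (majorana v : Op n) :=
    continuous_finsetSum _ fun v _ => (h u v).smul continuous_const
  refine continuous_finsetSum _ fun S _ => Continuous.fun_const_smul ?_ _
  exact continuous_list_prod _ fun u _ => h' u

/-- Permutations carry `γ_S` to a multiple of `γ_{σ S}`. -/
theorem heisenberg_coordPermutation_majoranaProd (σ : Equiv.Perm (Fin (2 * n)))
    (S : Finset (Fin (2 * n))) :
    ∃ a : ℂ, a ≠ 0 ∧ heisenberg (coordPermutation σ) (majoranaProd S) =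
      a • majoranaProd (S.map σ.toEmbedding) := by
  have h : heisenberg (coordPermutation σ) (majoranaProd S) =
      (((S.sort (· ≤ ·)).map σ).map majorana).prod := by
    rw [majoranaProd, map_list_prod, List.map_map, List.map_map]
    congr 2
    ext1 u
    exact heisenberg_coordPermutation_majorana σ u
  -- The permuted factors may be out of order, but their reflection signs depend only on the image
  -- set, which fixes the product up to a scalar.
  obtain ⟨a, ha⟩ := eq_smul_majoranaProd (S := S.map σ.toEmbedding)
    (A := heisenberg (coordPermutation σ) (majoranaProd S)) fun u => by
      rw [h, heisenberg_coordReflection_prod u ((Finset.sort_nodup _ _).map σ.injective)]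
      simp only [List.mem_map, Finset.mem_sort, Finset.mem_map, Equiv.coe_toEmbedding]
  refine ⟨a, ?_, ha⟩
  rintro rfl
  rw [zero_smul, map_eq_zero_iff _ (heisenberg_injective _)] at ha
  exact majoranaProd_ne_zero S ha

theorem majoranaProd_conjTranspose (S : Finset (Fin (2 * n))) :
    ∃ a : ℂ, a ≠ 0 ∧ (majoranaProd S)ᴴ = a • majoranaProd S := by
  obtain ⟨a, ha⟩ := eq_smul_majoranaProd (S := S) (A := (majoranaProd S)ᴴ) fun u => by
    rw [heisenberg_conjTranspose, heisenberg_coordReflection_majoranaProd,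
      Matrix.conjTranspose_smul]
    congr 1
    split_ifs <;> simp
  refine ⟨a, ?_, ha⟩
  rintro rfl
  rw [zero_smul, Matrix.conjTranspose_eq_zero] at ha
  exact majoranaProd_ne_zero S ha

/-- Odd products of Majorana operators anticommute with the parity. -/
theorem parity_mul_heisenberg_majoranaProd (Q : Matrix.orthogonalGroup (Fin (2 * n)) ℝ)
    (S : Finset (Fin (2 * n))) : parity n * heisenberg Q (majoranaProd S) =
      (-1 : ℂ) ^ S.card • (heisenberg Q (majoranaProd S) * parity n) := by
  rw [heisenberg_majoranaProd, ← Finset.length_sort (· ≤ ·) (s := S)]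
  induction S.sort (· ≤ ·) with
  | nil => simp
  | cons u l ih =>
    have h : parity n * ∑ v, (Q.1 u v : ℂ) • majorana v =
        - ((∑ v, (Q.1 u v : ℂ) • majorana v) * parity n) := by
      simp [Finset.mul_sum, Finset.sum_mul, parity_mul_majorana]
    rw [List.map_cons, List.prod_cons, ← mul_assoc, h, neg_mul, mul_assoc, ih, List.length_cons,
      pow_succ, mul_neg_one, neg_smul, mul_smul_comm, mul_assoc]

/-- Odd products of Majorana operators have no diagonal entries. -/
theorem heisenberg_majoranaProd_apply_self {S : Finset (Fin (2 * n))} (hS : Odd S.card)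
    (Q : Matrix.orthogonalGroup (Fin (2 * n)) ℝ) (x : Fin n → Fin 2) :
    heisenberg Q (majoranaProd S) x x = 0 := by
  have h := congrFun₂ (parity_mul_heisenberg_majoranaProd Q S) x x
  rw [hS.neg_one_pow, Matrix.smul_apply, parity, Matrix.diagonal_mul, Matrix.mul_diagonal] at h
  -- Both sides of `h` carry the same nonzero parity eigenvalue at x, so the entry equals its own
  -- negative.
  have h1 : (-1 : ℂ) ^ (∑ i, (x i : ℕ)) ≠ 0 := by simp
  have h2 : (-1 : ℂ) ^ (∑ i, (x i : ℕ)) * heisenberg Q (majoranaProd S) x x = 0 := by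
    refine self_eq_neg.1 (h.trans ?_)
    simp [mul_comm]
  exact (mul_eq_zero.1 h2).resolve_left h1

/-! ### Superoperators -/

theorem trace_majoranaProd_mul_conjTranspose (S : Finset (Fin (2 * n))) :
    (majoranaProd S * (majoranaProd S)ᴴ).trace = 2 ^ n := by
  rw [Matrix.trace_mul_comm, majoranaProd_conjTranspose_mul_self, trace_one_op]

theorem superproj_majoranaProd (S : Finset (Fin (2 * n))) (A : Op n) :
    superproj (majoranaProd S) A =
      ((2 ^ n)⁻¹ * ((majoranaProd S)ᴴ * A).trace) • majoranaProd S := by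
  have h : ((Real.sqrt (majoranaProd S * (majoranaProd S)ᴴ).trace.re : ℝ) : ℂ)⁻¹ *
      ((Real.sqrt (majoranaProd S * (majoranaProd S)ᴴ).trace.re : ℝ) : ℂ)⁻¹ = (2 ^ n)⁻¹ := by
    have h2 : ((2 : ℂ) ^ n).re = 2 ^ n := by
      rw [← Complex.ofReal_ofNat, ← Complex.ofReal_pow, Complex.ofReal_re]
    rw [trace_majoranaProd_mul_conjTranspose, h2, ← mul_inv, ← Complex.ofReal_mul,
      Real.mul_self_sqrt (by positivity)]
    simp
  rw [← h]
  simp only [superproj, superbra, superket, Matrix.conjTranspose_smul, LinearMap.smulRight_apply,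
    LinearMap.comp_apply, LinearMap.mulLeft_apply, Matrix.traceLinearMap_apply, smul_mul_assoc,
    Matrix.trace_smul, smul_smul, star_inv₀, Complex.star_def, Complex.conj_ofReal, smul_eq_mul]
  congr 1
  ring

theorem majoranaProjector_majoranaProd (m : ℕ) (S : Finset (Fin (2 * n))) :
    majoranaProjector n m (majoranaProd S) = if S.card = m then majoranaProd S else 0 := by
  simp only [majoranaProjector, LinearMap.sum_apply, superproj_majoranaProd,
    trace_majoranaProd_mul_majoranaProd, mul_ite, mul_zero, ite_smul, zero_smul,
    Finset.sum_ite_eq', Finset.mem_powersetCard, Finset.subset_univ, true_and]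
  simp

theorem majoranaProjector_comp (m m' : ℕ) (A : Op n) :
    majoranaProjector n m (majoranaProjector n m' A) =
      if m = m' then majoranaProjector n m A else 0 := by
  have h : majoranaProjector n m ∘ₗ majoranaProjector n m' =
      if m = m' then majoranaProjector n m else 0 := by
    refine op_linearMap_ext fun S => ?_
    rw [LinearMap.comp_apply, majoranaProjector_majoranaProd]
    split_ifs with h1 h2 h2 <;> simp [majoranaProjector_majoranaProd] <;> omega
  rw [← LinearMap.comp_apply, h]
  split_ifs <;> rfl

theorem superket_basisState (x : Fin n → Fin 2) : superket (basisState x) = basisState x := by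
  simp [superket, basisState]

theorem superbra_basisState (x : Fin n → Fin 2) (A : Op n) :
    superbra (basisState x) A = A x x := by
  simp only [superbra, superket_basisState, LinearMap.comp_apply, LinearMap.mulLeft_apply,
    Matrix.traceLinearMap_apply]
  rw [basisState, Matrix.conjTranspose_single, star_one, Matrix.trace_single_mul, one_smul]

theorem measurementChannel_apply (A : Op n) :
    measurementChannel n A = ∑ x, A x x • basisState x := by
  simp [measurementChannel, superproj, superket_basisState, superbra_basisState]

theorem noisyShadowIntegrand_apply (Λ : SuperOp n) (Q : Matrix.orthogonalGroup (Fin (2 * n)) ℝ)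
    (A : Op n) : noisyShadowIntegrand Λ Q A =
      ∑ x, Λ (heisenberg Q⁻¹ A) x x • heisenberg Q (basisState x) := by
  simp only [noisyShadowIntegrand, LinearMap.comp_apply, unitaryChannel_conjTranspose_eq,
    unitaryChannel_eq, measurementChannel_apply, map_sum, map_smul]

/-! ### Quantum channels -/

/-- Complete positivity at block size one, after identifying `Fin 1 × _` with its second factor. -/
theorem IsQuantumChannel.posSemidef {Λ : SuperOp n} (hΛ : IsQuantumChannel Λ) {A : Op n}
    (hA : A.PosSemidef) : (Λ A).PosSemidef := by
  have h := (hΛ.completely_positive 1 (A.submatrix Prod.snd Prod.snd)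
    (hA.submatrix _)).submatrix fun i : Fin n → Fin 2 => ((0 : Fin 1), i)
  exact h

theorem IsQuantumChannel.isHermitian {Λ : SuperOp n} (hΛ : IsQuantumChannel Λ) {A : Op n}
    (hA : A.IsHermitian) : (Λ A).IsHermitian := by
  have h1 := (hΛ.posSemidef (Matrix.posSemidef_conjTranspose_mul_self (A + 1))).isHermitian
  have h2 := (hΛ.posSemidef (Matrix.posSemidef_conjTranspose_mul_self (A - 1))).isHermitian
  -- Polarisation writes a Hermitian operator as a difference of positive ones, whose images are
  -- already known to be positive.
  have h : (4 : ℂ) • A = (A + 1)ᴴ * (A + 1) - (A - 1)ᴴ * (A - 1) := by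
    rw [Matrix.conjTranspose_add, Matrix.conjTranspose_sub, hA.eq, Matrix.conjTranspose_one]
    have h4 : (4 : ℂ) • A = A + A + A + A := by
      rw [show (4 : ℂ) = 1 + 1 + 1 + 1 by norm_num]
      simp only [add_smul, one_smul]
    rw [h4]; noncomm_ring
  have h3 : (Λ ((4 : ℂ) • A)).IsHermitian := by rw [h, map_sub]; exact h1.sub h2
  rw [map_smul] at h3
  have h4 : (4 : ℂ) • (Λ A)ᴴ = (4 : ℂ) • Λ A := by
    rw [← h3.eq, Matrix.conjTranspose_smul]; simp
  exact smul_right_injective _ (by norm_num : (4 : ℂ) ≠ 0) h4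

theorem IsQuantumChannel.map_conjTranspose {Λ : SuperOp n} (hΛ : IsQuantumChannel Λ) (A : Op n) :
    Λ Aᴴ = (Λ A)ᴴ := by
  have hB : ((realPart A : selfAdjoint (Op n)) : Op n)ᴴ = (realPart A : Op n) := (realPart A).2
  have hC : ((imaginaryPart A : selfAdjoint (Op n)) : Op n)ᴴ = (imaginaryPart A : Op n) :=
    (imaginaryPart A).2
  have hB' := hΛ.isHermitian hB
  have hC' := hΛ.isHermitian hC
  rw [← realPart_add_I_smul_imaginaryPart A]
  simp only [Matrix.conjTranspose_add, Matrix.conjTranspose_smul, map_add, map_smul, hB, hC,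
    hB'.eq, hC'.eq]

/-! ### Averaging over the orthogonal group -/

instance isProbabilityMeasure_orthogonalHaar (m : ℕ) :
    IsProbabilityMeasure (orthogonalHaar m) :=
  ⟨by simpa [orthogonalHaar] using
    Measure.haarMeasure_self (K₀ := (⊤ : TopologicalSpace.PositiveCompacts
      (Matrix.orthogonalGroup (Fin m) ℝ)))⟩

instance isHaarMeasure_orthogonalHaar (m : ℕ) : (orthogonalHaar m).IsHaarMeasure :=
  Measure.isHaarMeasure_haarMeasure _

/-- A right translate of Haar measure is again a Haar probability measure, so uniqueness identifies
the two. -/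
instance isMulRightInvariant_orthogonalHaar (m : ℕ) : (orthogonalHaar m).IsMulRightInvariant := by
  refine ⟨fun g => ?_⟩
  have : IsProbabilityMeasure ((orthogonalHaar m).map (· * g)) :=
    Measure.isProbabilityMeasure_map (measurable_mul_const g).aemeasurable
  have : ((orthogonalHaar m).map (· * g)).IsHaarMeasure :=
    Measure.isHaarMeasure_map_mul_right _ g
  exact Measure.isHaarMeasure_eq_of_isProbabilityMeasure _ _

theorem integrable_orthogonalHaar {m : ℕ} {f : Matrix.orthogonalGroup (Fin m) ℝ → ℂ}
    (hf : Continuous f) : Integrable f (orthogonalHaar m) :=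
  hf.integrable_of_hasCompactSupport (.of_compactSpace f)

theorem continuous_channel_heisenberg_inv (Λ : SuperOp n) (A : Op n) (x : Fin n → Fin 2) :
    Continuous fun Q : Matrix.orthogonalGroup (Fin (2 * n)) ℝ => Λ (heisenberg Q⁻¹ A) x x := by
  have hΛ : Continuous Λ := LinearMap.continuous_of_finiteDimensional Λ
  exact (hΛ.comp ((continuous_heisenberg A).comp continuous_inv)).matrix_elem x x

theorem continuous_noisyShadowIntegrand (Λ : SuperOp n) (A : Op n) :
    Continuous fun Q => noisyShadowIntegrand Λ Q A := by
  simp only [noisyShadowIntegrand_apply]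
  exact continuous_finsetSum _ fun x _ =>
    (continuous_channel_heisenberg_inv Λ A x).smul (continuous_heisenberg _)

theorem integrable_noisyShadowIntegrand (Λ : SuperOp n) (A : Op n) (i j : Fin n → Fin 2) :
    Integrable (fun Q => noisyShadowIntegrand Λ Q A i j) (orthogonalHaar (2 * n)) :=
  integrable_orthogonalHaar ((continuous_noisyShadowIntegrand Λ A).matrix_elem i j)

/-- Linear functionals commute with the integral that defines the shadow channel. -/
theorem integral_linearMap_noisyShadowIntegrand (Λ : SuperOp n) (A : Op n) (l : Op n →ₗ[ℂ] ℂ) :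
    ∫ Q, l (noisyShadowIntegrand Λ Q A) ∂(orthogonalHaar (2 * n)) = l (noisyShadowChannel Λ A) := by
  -- The channel is defined by integrating entries, so the functional is expanded over matrix units
  -- and the finite sums are taken out of the integral.
  have h (B : Op n) : l B = ∑ i, ∑ j, B i j * l (Matrix.single i j 1) := by
    conv_lhs => rw [Matrix.matrix_eq_sum_single B]
    simp only [map_sum]
    refine Finset.sum_congr rfl fun i _ => Finset.sum_congr rfl fun j _ => ?_
    rw [← smul_eq_mul, ← map_smul, Matrix.smul_single, smul_eq_mul, mul_one]
  simp only [h (noisyShadowIntegrand Λ _ A)]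
  rw [h, integral_finsetSum _ fun i _ => integrable_finsetSum _ fun j _ =>
    (integrable_noisyShadowIntegrand Λ A i j).mul_const _]
  refine Finset.sum_congr rfl fun i _ => ?_
  rw [integral_finsetSum _ fun j _ => (integrable_noisyShadowIntegrand Λ A i j).mul_const _]
  refine Finset.sum_congr rfl fun j _ => ?_
  rw [integral_mul_const]
  rfl

/-- The noisy shadow channel as a linear map. -/
def noisyShadowMap (Λ : SuperOp n) : SuperOp n where
  toFun := noisyShadowChannel Λ
  map_add' A B := by
    ext i j
    simp only [noisyShadowChannel, map_add, Matrix.add_apply, Matrix.of_apply]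
    exact integral_add (integrable_noisyShadowIntegrand Λ A i j)
      (integrable_noisyShadowIntegrand Λ B i j)
  map_smul' a A := by
    ext i j
    simp only [noisyShadowChannel, map_smul, Matrix.smul_apply, Matrix.of_apply, smul_eq_mul,
      RingHom.id_apply]
    exact integral_const_mul _ _

theorem noisyShadowMap_apply (Λ : SuperOp n) (A : Op n) :
    noisyShadowMap Λ A = noisyShadowChannel Λ A := rfl

/-- Covariance before averaging: rotating the input amounts to translating Q and rotating the
output. -/
theorem noisyShadowIntegrand_heisenberg (Λ : SuperOp n)
    (Q R : Matrix.orthogonalGroup (Fin (2 * n)) ℝ) (A : Op n) :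
    noisyShadowIntegrand Λ Q (heisenberg R A) =
      heisenberg R (noisyShadowIntegrand Λ (Q * R⁻¹) A) := by
  simp only [noisyShadowIntegrand_apply, map_sum, map_smul, heisenberg_heisenberg, mul_inv_rev,
    inv_inv, inv_mul_cancel_right]

theorem noisyShadowMap_heisenberg (Λ : SuperOp n) (R : Matrix.orthogonalGroup (Fin (2 * n)) ℝ)
    (A : Op n) : noisyShadowMap Λ (heisenberg R A) = heisenberg R (noisyShadowMap Λ A) := by
  ext i j
  let l : Op n →ₗ[ℂ] ℂ := Matrix.entryLinearMap ℂ ℂ i j ∘ₗ (heisenberg R).toLinearMap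
  have h := integral_linearMap_noisyShadowIntegrand Λ A l
  -- Right invariance absorbs the translation produced by covariance.
  rw [← integral_mul_right_eq_self _ R⁻¹] at h
  refine Eq.trans ?_ h
  simp only [noisyShadowMap_apply, noisyShadowChannel, Matrix.of_apply,
    noisyShadowIntegrand_heisenberg]
  rfl

theorem noisyShadowMap_conjTranspose {Λ : SuperOp n} (hΛ : IsQuantumChannel Λ) (A : Op n) :
    noisyShadowMap Λ Aᴴ = (noisyShadowMap Λ A)ᴴ := by
  have h (Q) : noisyShadowIntegrand Λ Q Aᴴ = (noisyShadowIntegrand Λ Q A)ᴴ := by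
    have hb (x : Fin n → Fin 2) : (basisState x)ᴴ = basisState x := by
      simp [basisState]
    rw [noisyShadowIntegrand_apply, noisyShadowIntegrand_apply, Matrix.conjTranspose_sum]
    refine Finset.sum_congr rfl fun x _ => ?_
    rw [Matrix.conjTranspose_smul, ← heisenberg_conjTranspose, hb, heisenberg_conjTranspose,
      hΛ.map_conjTranspose, Matrix.conjTranspose_apply]
  ext i j
  simp only [noisyShadowMap_apply, noisyShadowChannel, Matrix.of_apply, h,
    Matrix.conjTranspose_apply, Complex.star_def]
  exact integral_conj

/-! ### Eigenvalues of the noisy shadow channel -/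

/-- Commuting with reflections preserves their joint eigenspaces, each of which is a line spanned by
one γ_S. -/
theorem exists_noisyShadowMap_majoranaProd (Λ : SuperOp n) (S : Finset (Fin (2 * n))) :
    ∃ c : ℂ, noisyShadowMap Λ (majoranaProd S) = c • majoranaProd S :=
  eq_smul_majoranaProd fun u => by
    rw [← noisyShadowMap_heisenberg, heisenberg_coordReflection_majoranaProd, map_smul]

theorem exists_perm_map_eq {α : Type*} [Fintype α] [DecidableEq α] {S T : Finset α}
    (h : S.card = T.card) : ∃ σ : Equiv.Perm α, S.map σ.toEmbedding = T := by
  let e := Finset.equivOfCardEq h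
  refine ⟨e.extendSubtype, Finset.eq_of_subset_of_card_le ?_ (by simp [h])⟩
  intro a ha
  obtain ⟨b, hb, rfl⟩ := Finset.mem_map.1 ha
  exact e.extendSubtype_mem b hb

/-- A permutation carrying S to T intertwines the two eigenvector equations, and its nonzero scalar
cancels. -/
theorem noisyShadowMap_majoranaProd_of_card_eq {Λ : SuperOp n} {S T : Finset (Fin (2 * n))}
    (h : S.card = T.card) {c : ℂ} (hc : noisyShadowMap Λ (majoranaProd S) = c • majoranaProd S) :
    noisyShadowMap Λ (majoranaProd T) = c • majoranaProd T := by
  obtain ⟨σ, rfl⟩ := exists_perm_map_eq h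
  obtain ⟨a, ha, h⟩ := heisenberg_coordPermutation_majoranaProd σ S
  have h' := noisyShadowMap_heisenberg Λ (coordPermutation σ) (majoranaProd S)
  rw [hc, map_smul, h, map_smul, smul_comm] at h'
  exact smul_right_injective _ ha h'

/-- The channel commutes with adjoints and γ_S† is a nonzero multiple of γ_S, so the eigenvalue
equals its conjugate. -/
theorem noisyShadowMap_eigenvalue_real {Λ : SuperOp n} (hΛ : IsQuantumChannel Λ)
    {S : Finset (Fin (2 * n))} {c : ℂ}
    (hc : noisyShadowMap Λ (majoranaProd S) = c • majoranaProd S) : (c.re : ℂ) = c := by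
  obtain ⟨a, ha, h⟩ := majoranaProd_conjTranspose S
  have h' := noisyShadowMap_conjTranspose hΛ (majoranaProd S)
  rw [hc, Matrix.conjTranspose_smul, h, map_smul, hc, smul_smul, smul_smul, mul_comm] at h'
  have h2 := smul_left_injective ℂ (majoranaProd_ne_zero S) h'
  exact Complex.conj_eq_iff_re.1 (mul_right_cancel₀ ha h2).symm

theorem noisyShadowMap_majoranaProd_of_odd (Λ : SuperOp n) {S : Finset (Fin (2 * n))}
    (hS : Odd S.card) : noisyShadowMap Λ (majoranaProd S) = 0 := by
  obtain ⟨c, hc⟩ := exists_noisyShadowMap_majoranaProd Λ S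
  have h := integral_linearMap_noisyShadowIntegrand Λ (majoranaProd S)
    (Matrix.traceLinearMap (Fin n → Fin 2) ℂ ℂ ∘ₗ LinearMap.mulLeft ℂ (majoranaProd S)ᴴ)
  have h0 (Q) : ((majoranaProd S)ᴴ * noisyShadowIntegrand Λ Q (majoranaProd S)).trace = 0 := by
    rw [noisyShadowIntegrand_apply, Finset.mul_sum, Matrix.trace_sum]
    refine Finset.sum_eq_zero fun x _ => ?_
    -- Pulling γ_S back through the automorphism turns the overlap with a rotated basis state into a
    -- diagonal entry of a rotated odd product, which is zero.
    have h1 : (majoranaProd S)ᴴ * heisenberg Q (basisState x) =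
        heisenberg Q ((heisenberg Q⁻¹ (majoranaProd S))ᴴ * basisState x) := by
      rw [map_mul, ← heisenberg_conjTranspose, heisenberg_heisenberg, inv_mul_cancel,
        heisenberg_one, AlgHom.id_apply]
    rw [mul_smul_comm, h1, Matrix.trace_smul, trace_heisenberg, basisState,
      Matrix.trace_mul_single, Matrix.conjTranspose_apply,
      heisenberg_majoranaProd_apply_self hS]
    simp
  simp only [LinearMap.comp_apply, LinearMap.mulLeft_apply, Matrix.traceLinearMap_apply, h0,
    integral_zero, ← noisyShadowMap_apply] at h
  rw [hc, mul_smul_comm, majoranaProd_conjTranspose_mul_self, Matrix.trace_smul, trace_one_op] at h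
  have hc0 : c = 0 := by simpa using h.symm
  rw [hc, hc0, zero_smul]

theorem exists_isDecomposition {Λ : SuperOp n} (hΛ : IsQuantumChannel Λ) :
    ∃ f : Fin (n + 1) → ℝ, IsDecomposition Λ f := by
  have hex (k : Fin (n + 1)) : ∃ c : ℝ, ∀ S : Finset (Fin (2 * n)), S.card = 2 * (k : ℕ) →
      noisyShadowMap Λ (majoranaProd S) = (c : ℂ) • majoranaProd S := by
    -- One representative set of size 2k ≤ 2n supplies the coefficient for all sets of that size.
    obtain ⟨S, -, hS⟩ := Finset.exists_subset_card_eq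
      (s := (Finset.univ : Finset (Fin (2 * n)))) (n := 2 * (k : ℕ)) (by simp; omega)
    obtain ⟨c, hc⟩ := exists_noisyShadowMap_majoranaProd Λ S
    refine ⟨c.re, fun T hT => ?_⟩
    rw [noisyShadowMap_eigenvalue_real hΛ hc]
    exact noisyShadowMap_majoranaProd_of_card_eq (hS.trans hT.symm) hc
  choose f hf using hex
  refine ⟨f, fun A => ?_⟩
  have h : noisyShadowMap Λ =
      ∑ k : Fin (n + 1), (f k : ℂ) • majoranaProjector n (2 * (k : ℕ)) := by
    refine op_linearMap_ext fun S => ?_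
    simp only [LinearMap.sum_apply, LinearMap.smul_apply, majoranaProjector_majoranaProd]
    rcases Nat.even_or_odd' S.card with ⟨k, hk | hk⟩
    · have hkn : k < n + 1 := by
        have := S.card_le_univ
        rw [Fintype.card_fin] at this
        omega
      rw [hf ⟨k, hkn⟩ S hk, Finset.sum_eq_single ⟨k, hkn⟩, if_pos hk]
      · intro j _ hj
        rw [if_neg, smul_zero]
        intro h
        exact hj (Fin.ext (by simp only; omega))
      · simp
    · rw [noisyShadowMap_majoranaProd_of_odd Λ ⟨k, hk⟩, Finset.sum_eq_zero]
      intro j _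
      rw [if_neg (by omega), smul_zero]
  rw [← noisyShadowMap_apply, h]
  simp

/-! ### Diagonal entries of Majorana products -/

theorem flipBit_eq_add (x : Fin n → Fin 2) (j : Fin n) : flipBit x j = x + Pi.single j 1 := by
  ext i : 1
  rcases eq_or_ne i j with rfl | h
  · rw [flipBit, Function.update_self, Pi.add_apply, Pi.single_eq_same]
    generalize x i = a
    revert a; decide
  · rw [flipBit, Function.update_of_ne h, Pi.add_apply, Pi.single_eq_of_ne h, add_zero]

theorem norm_majoranaPhase (u : Fin (2 * n)) (x : Fin n → Fin 2) : ‖majoranaPhase u x‖ = 1 := by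
  unfold majoranaPhase jwSign
  split_ifs <;> simp

/-- Each Majorana operator flips the bit of its mode up to a phase, so a product translates basis
labels by a vector of (ℤ/2)ⁿ with entries of modulus one. -/
theorem norm_majorana_list_prod_apply (l : List (Fin (2 * n))) (y x : Fin n → Fin 2) :
    ‖(l.map majorana).prod y x‖ =
      if y = x + (l.map fun u => Pi.single (mode u) 1).sum then 1 else 0 := by
  induction l generalizing y with
  | nil => simp only [List.map_nil, List.prod_nil, List.sum_nil, add_zero, Matrix.one_apply]
           split_ifs <;> simp
  | cons u l ih =>
    have h : (majorana u * (l.map majorana).prod) y x =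
        majoranaPhase u (flipBit y (mode u)) * (l.map majorana).prod (flipBit y (mode u)) x := by
      rw [Matrix.mul_apply, Finset.sum_eq_single (flipBit y (mode u))]
      · rw [majorana_apply, flipBit_flipBit, if_pos rfl]
      · intro z _ hz
        rw [majorana_apply, if_neg, zero_mul]
        rintro rfl
        exact hz (flipBit_flipBit _ _).symm
      · simp
    rw [List.map_cons, List.prod_cons, h, norm_mul, norm_majoranaPhase, one_mul, ih]
    refine if_congr ?_ rfl rfl
    rw [List.map_cons, List.sum_cons, ← add_assoc, add_right_comm, ← flipBit_eq_add]
    constructor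
    · intro h; rw [← h, flipBit_flipBit]
    · rintro rfl; rw [flipBit_flipBit]

/-- The set `S` contains each mode fully or not at all. -/
def IsPaired (S : Finset (Fin (2 * n))) : Prop :=
  ∀ j, Even (S.filter fun u => mode u = j).card

/-- A diagonal entry survives exactly when the total translation is zero, that is, when every mode
is hit an even number of times. -/
theorem norm_majoranaProd_apply_self [DecidablePred (IsPaired (n := n))]
    (S : Finset (Fin (2 * n))) (x : Fin n → Fin 2) :
    ‖majoranaProd S x x‖ = if IsPaired S then 1 else 0 := by
  rw [majoranaProd, norm_majorana_list_prod_apply]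
  refine if_congr ?_ rfl rfl
  have h : ((S.sort (· ≤ ·)).map fun u => (Pi.single (mode u) 1 : Fin n → Fin 2)).sum =
      ∑ u ∈ S, Pi.single (mode u) 1 := by
    rw [← List.sum_toFinset _ (Finset.sort_nodup _ _), Finset.sort_toFinset]
  rw [h, left_eq_add, funext_iff]
  refine forall_congr' fun j => ?_
  rw [Finset.sum_apply, Pi.zero_apply]
  -- `Fin 2` is read as `ZMod 2`, so that vanishing of the sum becomes evenness of a cardinality.
  have h2 : ∑ u ∈ S, (Pi.single (mode u) 1 : Fin n → Fin 2) j =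
      ((S.filter fun u => mode u = j).card : ZMod 2) := by
    rw [Finset.card_filter, Nat.cast_sum]
    refine Finset.sum_congr rfl fun u _ => ?_
    rw [Pi.single_apply]
    simp only [eq_comm (a := j)]
    split_ifs <;> rfl
  rw [h2]
  exact ZMod.natCast_eq_zero_iff_even

theorem card_filter_mode_eq (j : Fin n) :
    ((Finset.univ : Finset (Fin (2 * n))).filter fun u => mode u = j).card = 2 := by
  have hj := j.2
  have h : ((Finset.univ : Finset (Fin (2 * n))).filter fun u => mode u = j) =
      {⟨2 * j, by omega⟩, ⟨2 * j + 1, by omega⟩} := by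
    ext u
    simp only [mode, Finset.mem_filter, Finset.mem_univ, true_and, Finset.mem_insert,
      Finset.mem_singleton, Fin.ext_iff]
    omega
  rw [h, Finset.card_pair]
  simp [Fin.ext_iff]

theorem card_filter_mode_mem (T : Finset (Fin n)) :
    ((Finset.univ : Finset (Fin (2 * n))).filter fun u => mode u ∈ T).card = 2 * T.card := by
  rw [Finset.card_eq_sum_card_fiberwise (f := mode) (t := T) (fun u hu => by simpa using hu),
    Finset.sum_congr rfl (g := fun _ => 2), Finset.sum_const, smul_eq_mul, mul_comm]
  intro j hj
  rw [Finset.filter_filter]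
  refine Eq.trans ?_ (card_filter_mode_eq j)
  congr 1
  ext u
  simp only [Finset.mem_filter, Finset.mem_univ, true_and, and_iff_right_iff_imp]
  rintro rfl
  exact hj

theorem IsPaired.filter_mode_mem_image {S : Finset (Fin (2 * n))} (hS : IsPaired S) :
    (Finset.univ.filter fun u => mode u ∈ S.image mode) = S := by
  ext u
  simp only [Finset.mem_filter, Finset.mem_univ, true_and, Finset.mem_image]
  refine ⟨?_, fun hu => ⟨u, hu, rfl⟩⟩
  rintro ⟨v, hv, hvu⟩
  have hsub : (S.filter fun w => mode w = mode u) ⊆ Finset.univ.filter fun w => mode w = mode u :=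
    Finset.filter_subset_filter _ (Finset.subset_univ _)
  have hpos : 0 < (S.filter fun w => mode w = mode u).card :=
    Finset.card_pos.2 ⟨v, by simp [hv, hvu]⟩
  have heven := hS (mode u)
  -- A nonempty subset of even size in a two-element fibre is the whole fibre.
  have heq := Finset.eq_of_subset_of_card_le hsub (by
    rw [card_filter_mode_eq]
    obtain ⟨r, hr⟩ := heven
    omega)
  have : u ∈ S.filter fun w => mode w = mode u := by rw [heq]; simp
  exact (Finset.mem_filter.1 this).1

theorem isPaired_filter_mode_mem (T : Finset (Fin n)) :
    IsPaired ((Finset.univ : Finset (Fin (2 * n))).filter fun u => mode u ∈ T) := by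
  intro j
  rw [Finset.filter_filter]
  by_cases hj : j ∈ T
  · have : ((Finset.univ : Finset (Fin (2 * n))).filter fun u => mode u ∈ T ∧ mode u = j) =
        Finset.univ.filter fun u => mode u = j := by
      ext u
      simp only [Finset.mem_filter, Finset.mem_univ, true_and, and_iff_right_iff_imp]
      rintro rfl
      exact hj
    rw [this, card_filter_mode_eq]
    exact even_two
  · rw [Finset.filter_false_of_mem]
    · simp
    · rintro u - ⟨h, rfl⟩
      exact hj h

/-- Taking the set of occupied modes, with preimage under `mode` as inverse, matches paired sets of
size 2k with k-subsets of the modes. -/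
theorem card_isPaired [DecidablePred (IsPaired (n := n))] (k : ℕ) :
    (((Finset.univ : Finset (Fin (2 * n))).powersetCard (2 * k)).filter IsPaired).card =
      n.choose k := by
  have h : ((Finset.univ : Finset (Fin n)).powersetCard k).card = n.choose k := by simp
  rw [← h]
  refine Finset.card_nbij' (fun S => S.image mode)
    (fun T => Finset.univ.filter fun u => mode u ∈ T) ?_ ?_ ?_ ?_
  · intro S hS
    simp only [Finset.coe_filter, Finset.mem_powersetCard, Set.mem_ofPred_eq] at hS
    have h := card_filter_mode_mem (S.image mode)
    rw [hS.2.filter_mode_mem_image, hS.1.2] at h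
    simp only [Finset.mem_coe, Finset.mem_powersetCard, Finset.subset_univ, true_and]
    omega
  · intro T hT
    simp only [Finset.mem_coe, Finset.mem_powersetCard] at hT
    simp only [Finset.mem_coe, Finset.mem_filter, Finset.mem_powersetCard, Finset.subset_univ,
      true_and]
    exact ⟨by rw [card_filter_mode_mem, hT.2], isPaired_filter_mode_mem T⟩
  · intro S hS
    simp only [Finset.coe_filter, Set.mem_ofPred_eq] at hS
    exact hS.2.filter_mode_mem_image
  · intro T _
    ext j
    simp only [Finset.mem_image, Finset.mem_filter, Finset.mem_univ, true_and]
    refine ⟨by rintro ⟨u, hu, rfl⟩; exact hu, fun hj => ?_⟩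
    obtain ⟨u, hu⟩ := Finset.card_pos.1 ((card_filter_mode_eq j).symm ▸ two_pos)
    obtain rfl := (Finset.mem_filter.1 hu).2
    exact ⟨u, hj, rfl⟩

/-- `⟨⟨0|𝒫_{2k}|0⟩⟩ = C(n, k) / 2ⁿ`. -/
theorem majoranaProjector_basisState_apply_self (k : ℕ) (x : Fin n → Fin 2) :
    majoranaProjector n (2 * k) (basisState x) x x = (2 ^ n)⁻¹ * (n.choose k : ℂ) := by
  classical
  have h (S : Finset (Fin (2 * n))) : superproj (majoranaProd S) (basisState x) x x =
      (2 ^ n)⁻¹ * if IsPaired S then 1 else 0 := by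
    -- Phases cancel in |γ_S(x,x)|², so every paired set contributes the same 2⁻ⁿ.
    have h1 : star (majoranaProd S x x) * majoranaProd S x x =
        ((‖majoranaProd S x x‖ ^ 2 : ℝ) : ℂ) := by
      rw [Complex.star_def, Complex.conj_mul']
      simp
    rw [superproj_majoranaProd, Matrix.smul_apply, basisState, Matrix.trace_mul_single,
      Matrix.conjTranspose_apply, smul_eq_mul, mul_assoc]
    simp only [MulOpposite.op_one, one_smul]
    rw [h1, norm_majoranaProd_apply_self]
    split_ifs <;> simp
  rw [majoranaProjector, LinearMap.sum_apply, Matrix.sum_apply]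
  simp only [h]
  rw [← Finset.mul_sum, Finset.sum_boole, card_isPaired]

/-! ### The calibration experiment -/

theorem posSemidef_basisState (x : Fin n → Fin 2) : (basisState x : Op n).PosSemidef := by
  have h : (basisState x : Op n) = (basisState x)ᴴ * basisState x := by
    simp [basisState]
  rw [h]
  exact Matrix.posSemidef_conjTranspose_mul_self _

theorem posSemidef_heisenberg (Q : Matrix.orthogonalGroup (Fin (2 * n)) ℝ) {A : Op n}
    (hA : A.PosSemidef) : (heisenberg Q A).PosSemidef := by
  rw [heisenberg_apply]
  exact hA.conjTranspose_mul_mul_same _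

theorem outcome_nonneg {Λ : SuperOp n} (hΛ : IsQuantumChannel Λ)
    (Q : Matrix.orthogonalGroup (Fin (2 * n)) ℝ) (x : Fin n → Fin 2) :
    0 ≤ Λ (heisenberg Q⁻¹ (basisState 0)) x x :=
  (hΛ.posSemidef (posSemidef_heisenberg _ (posSemidef_basisState 0))).diag_nonneg

theorem outcomeProb_eq (Λ : SuperOp n) (Q : Matrix.orthogonalGroup (Fin (2 * n)) ℝ)
    (x : Fin n → Fin 2) : outcomeProb Λ Q x =
      (Λ (heisenberg Q⁻¹ (basisState 0)) x x).re := by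
  rw [outcomeProb, unitaryChannel_eq]

theorem outcomeProb_nonneg {Λ : SuperOp n} (hΛ : IsQuantumChannel Λ)
    (Q : Matrix.orthogonalGroup (Fin (2 * n)) ℝ) (x : Fin n → Fin 2) :
    0 ≤ outcomeProb Λ Q x := by
  rw [outcomeProb_eq]
  exact (Complex.nonneg_iff.1 (outcome_nonneg hΛ Q x)).1

/-- Positivity makes the diagonal entry real, so taking the real part in `outcomeProb` loses
nothing. -/
theorem ofReal_outcomeProb {Λ : SuperOp n} (hΛ : IsQuantumChannel Λ)
    (Q : Matrix.orthogonalGroup (Fin (2 * n)) ℝ) (x : Fin n → Fin 2) :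
    (outcomeProb Λ Q x : ℂ) = Λ (heisenberg Q⁻¹ (basisState 0)) x x := by
  rw [outcomeProb_eq]
  exact (Complex.eq_re_of_ofReal_le (by rw [Complex.ofReal_zero]; exact outcome_nonneg hΛ Q x)).symm

theorem sum_outcomeProb {Λ : SuperOp n} (hΛ : IsQuantumChannel Λ)
    (Q : Matrix.orthogonalGroup (Fin (2 * n)) ℝ) :
    ∑ x, outcomeProb Λ Q x = 1 := by
  have h := hΛ.trace_preserving (heisenberg Q⁻¹ (basisState 0))
  rw [trace_heisenberg, basisState, Matrix.trace_single_eq_same, ← basisState, Matrix.trace] at h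
  have h' : ((∑ x, outcomeProb Λ Q x : ℝ) : ℂ) = 1 := by
    rw [← h, Complex.ofReal_sum]
    exact Finset.sum_congr rfl fun x _ => ofReal_outcomeProb hΛ Q x
  exact_mod_cast h'

theorem continuous_outcomeProb (Λ : SuperOp n) (x : Fin n → Fin 2) :
    Continuous fun Q => outcomeProb Λ Q x := by
  simp only [outcomeProb_eq]
  exact Complex.continuous_re.comp (continuous_channel_heisenberg_inv Λ _ x)

theorem measurable_ofReal_outcomeProb (Λ : SuperOp n) (x : Fin n → Fin 2) :
    Measurable fun Q => ENNReal.ofReal (outcomeProb Λ Q x) :=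
  (continuous_outcomeProb Λ x).measurable.ennreal_ofReal

theorem isProbabilityMeasure_calibrationLaw {Λ : SuperOp n} (hΛ : IsQuantumChannel Λ) :
    IsProbabilityMeasure (calibrationLaw Λ) := by
  constructor
  simp only [calibrationLaw, Measure.coe_finsetSum, Finset.sum_apply]
  have h (x : Fin n → Fin 2) :
      ((orthogonalHaar (2 * n)).withDensity fun Q => ENNReal.ofReal (outcomeProb Λ Q x)).map
        (fun Q => (Q, x)) Set.univ =
      ∫⁻ Q, ENNReal.ofReal (outcomeProb Λ Q x) ∂(orthogonalHaar (2 * n)) := by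
    rw [Measure.map_apply measurable_prodMk_right MeasurableSet.univ, Set.preimage_univ,
      withDensity_apply _ MeasurableSet.univ, Measure.restrict_univ]
  simp only [h]
  rw [← lintegral_finsetSum _ fun x _ => measurable_ofReal_outcomeProb Λ x]
  simp only [← ENNReal.ofReal_sum_of_nonneg fun x _ => outcomeProb_nonneg hΛ _ x,
    sum_outcomeProb hΛ, ENNReal.ofReal_one, lintegral_one, measure_univ]

/-- There are finitely many outcomes, and on each slice both the density and the integrand are
continuous on a compact group. -/
theorem integrable_calibrationLaw {Λ : SuperOp n} (hΛ : IsQuantumChannel Λ)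
    {g : Matrix.orthogonalGroup (Fin (2 * n)) ℝ × (Fin n → Fin 2) → ℂ}
    (hg : ∀ x, Continuous fun Q => g (Q, x)) : Integrable g (calibrationLaw Λ) := by
  rw [calibrationLaw, integrable_finsetSum_measure]
  intro x _
  rw [(measurableEmbedding_prod_mk_right x).integrable_map_iff,
    integrable_withDensity_iff_integrable_smul' (measurable_ofReal_outcomeProb Λ x)
      (by simp)]
  simp only [ENNReal.toReal_ofReal (outcomeProb_nonneg hΛ _ x)]
  exact integrable_orthogonalHaar ((continuous_outcomeProb Λ x).smul (hg x))

theorem integral_calibrationLaw {Λ : SuperOp n} (hΛ : IsQuantumChannel Λ)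
    {g : Matrix.orthogonalGroup (Fin (2 * n)) ℝ × (Fin n → Fin 2) → ℂ}
    (hg : ∀ x, Continuous fun Q => g (Q, x)) : ∫ s, g s ∂(calibrationLaw Λ) =
      ∫ Q, ∑ x, (outcomeProb Λ Q x : ℂ) * g (Q, x) ∂(orthogonalHaar (2 * n)) := by
  have hi := integrable_calibrationLaw hΛ hg
  rw [calibrationLaw, integrable_finsetSum_measure] at hi
  rw [calibrationLaw, integral_finsetSum_measure hi, integral_finsetSum]
  · refine Finset.sum_congr rfl fun x _ => ?_
    rw [(measurableEmbedding_prod_mk_right x).integral_map,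
      integral_withDensity_eq_integral_toReal_smul (measurable_ofReal_outcomeProb Λ x)
        (by simp)]
    simp only [ENNReal.toReal_ofReal (outcomeProb_nonneg hΛ _ x), Complex.real_smul]
  · exact fun x _ => integrable_orthogonalHaar
      ((Complex.continuous_ofReal.comp (continuous_outcomeProb Λ x)).mul (hg x))

/-- The functional `A ↦ 2ⁿ ⟨⟨0| 𝒫_{2k} A / C(n, k)`. -/
def estimatorFunctional (n k : ℕ) : Op n →ₗ[ℂ] ℂ :=
  (2 ^ n / (n.choose k : ℂ)) •
    (Matrix.entryLinearMap ℂ ℂ 0 0 ∘ₗ majoranaProjector n (2 * k))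

theorem estimatorFunctional_apply (k : ℕ) (A : Op n) : estimatorFunctional n k A =
    2 ^ n / (n.choose k : ℂ) * majoranaProjector n (2 * k) A 0 0 := rfl

theorem calibrationEstimator_apply (k : ℕ) (Q : Matrix.orthogonalGroup (Fin (2 * n)) ℝ)
    (x : Fin n → Fin 2) :
    calibrationEstimator k (Q, x) = estimatorFunctional n k (heisenberg Q (basisState x)) := by
  rw [calibrationEstimator, superket_basisState, superbra_basisState,
    unitaryChannel_conjTranspose_eq, estimatorFunctional_apply]
  ring

theorem continuous_calibrationEstimator (k : ℕ) (x : Fin n → Fin 2) :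
    Continuous fun Q => calibrationEstimator (n := n) k (Q, x) := by
  simp only [calibrationEstimator_apply]
  exact (LinearMap.continuous_of_finiteDimensional (estimatorFunctional n k)).comp
    (continuous_heisenberg _)

/-- The outcome-weighted sum of estimator values is `estimatorFunctional` applied to the channel
integrand at |0⟩⟨0|, so averaging gives its value on the averaged channel. Any given decomposition
can then be substituted; no uniqueness of the coefficients is needed. -/
theorem integral_calibrationEstimator {Λ : SuperOp n} (hΛ : IsQuantumChannel Λ)
    {f : Fin (n + 1) → ℝ} (hf : IsDecomposition Λ f) (k : Fin (n + 1)) :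
    ∫ s, calibrationEstimator (k : ℕ) s ∂(calibrationLaw Λ) = (f k : ℂ) := by
  rw [integral_calibrationLaw hΛ (continuous_calibrationEstimator k)]
  have h := integral_linearMap_noisyShadowIntegrand Λ (basisState 0) (estimatorFunctional n k)
  simp only [noisyShadowIntegrand_apply, map_sum, map_smul, smul_eq_mul] at h
  simp only [calibrationEstimator_apply, ofReal_outcomeProb hΛ]
  rw [h, hf, estimatorFunctional_apply]
  simp only [map_sum, map_smul, majoranaProjector_comp]
  -- Projectors of different degree annihilate one another, so 𝒫_{2k} isolates the k-th coefficient.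
  rw [Finset.sum_eq_single k, if_pos rfl, Matrix.smul_apply,
    majoranaProjector_basisState_apply_self, smul_eq_mul]
  · have h1 : (n.choose k : ℂ) ≠ 0 :=
      Nat.cast_ne_zero.2 (Nat.choose_pos (Nat.lt_succ_iff.1 k.2)).ne'
    field_simp
  · intro j _ hj
    rw [if_neg, smul_zero]
    intro h
    exact hj (Fin.ext (by omega))
  · simp

end FermionicShadow

end

theorem theorem2 (n : ℕ) (Λ : SuperOp n) (hΛ : IsQuantumChannel Λ) :
    (∀ (A : Op n) (i j : Fin n → Fin 2),
      Integrable (fun Q => noisyShadowIntegrand Λ Q A i j) (orthogonalHaar (2 * n))) ∧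
    IsProbabilityMeasure (calibrationLaw Λ) ∧
    (∃ f : Fin (n + 1) → ℝ, IsDecomposition Λ f) ∧
    ∀ f : Fin (n + 1) → ℝ, IsDecomposition Λ f → ∀ k : Fin (n + 1),
      Integrable (calibrationEstimator (k : ℕ)) (calibrationLaw Λ) ∧
      ∫ s, calibrationEstimator (k : ℕ) s ∂(calibrationLaw Λ) = (f k : ℂ) :=
  ⟨integrable_noisyShadowIntegrand Λ, isProbabilityMeasure_calibrationLaw hΛ,
    exists_isDecomposition hΛ, fun _ hf k =>
      ⟨integrable_calibrationLaw hΛ (continuous_calibrationEstimator k),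
        integral_calibrationEstimator hΛ hf k⟩⟩
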